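/- Let $(M,g)$ be an oriented pseudo-Riemannian spin manifold of dimension $2n$ with Levi-Civita connection $\nabla$, complex spinor bundle $S$ (rank $2^n$), Clifford multiplication $\gamma$, $\gamma(X)\gamma(Y)+\gamma(Y)\gamma(X)=-2g(X,Y)$, and chirality operator $\gamma^*$ ($\gamma^*=\gamma^1\cdots\gamma^{2n}$ or $i\,\gamma^1\cdots\gamma^{2n}$ in oriented orthonormal frames, so that $(\gamma^*)^2=1$). Let $C$ be a charge conjugation on $S$, that is, a nondegenerate complex bilinear form, parallel for the Levi-Civita connection, such that $C(\phi,\psi)$ and $C(\phi,\gamma(X)\psi)$ each have a definite symmetry $\Delta_0,\Delta_1\in\{\pm1\}$ under exchange of $\phi$ and $\psi$. Let $$\tau_0=\begin{pmatrix}1&0\\0&1\end{pmatrix},\quad \tau_1=\begin{pmatrix}0&1\\1&0\end{pmatrix},\quad \tau_2=\begin{pmatrix}0&1\\-1&0\end{pmatrix},\quad \tau_3=\begin{pmatrix}1&0\\0&-1\end{pmatrix},$$ and equip the twisted spinor bundle $S\oplus S=S\otimes\mathbb C^2$ with the form $\mathbf C=C\otimes\tau_k$ for some $k\in\{0,1,2,3\}$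 (for $k=0$ it is $C\oplus C$), with Clifford multiplication $\gamma\otimes\mathbb 1$, and with the connection $\nabla$ induced by Levi-Civita. For a connection $D$ on $S\oplus S$ let $D^C$ be the connection determined by $(D\otimes\mathbb 1+\mathbb 1\otimes D^C)\mathbf C=0$, i.e. $X(\mathbf C(\phi,\psi))=\mathbf C(D_X\phi,\psi)+\mathbf C(\phi,D^C_X\psi)$; put $(\hat D_Z\gamma)(X)\xi=D_Z(\gamma(X)\xi)-\gamma(\nabla_ZX)\xi-\gamma(X)D^C_Z\xi$, and let $\mathcal T^D(X,Y)=(\hat D_X\gamma)(Y)-(\hat D_Y\gamma)(X)$ be the torsion of $D$. The connection $D$ is called admissible if $(\hat D_X\gamma)(Y)$ is skew symmetric in $X,Y$. For $i,j\in\{0,1,2,3\}$ and a sign $w\in\{\pm1\}$ put $P_w=\mathbb 1\otimes\tau_i+w\,\gamma^*\otimes\tau_j$. An $\mathrm{End}(S\oplus S)$-valued $1$-form (or $2$-form) is called proportional to $P_w$ if it equals $(B\otimes\mathbb 1)P_w$ for some $\mathrm{End}(S)$-valued $1$-form (or $2$-form) $B$. Let $D$ be a connection on $S\oplus S$ with a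 contribution $A$, an $\mathrm{End}(S\oplus S)$-valued $1$-form, which is proportional to $P_w$ and admissible, in the sense that $\nabla+A$ is an admissible connection. Then the parts of $D^C$ and of the torsion of $D$ which are associated with $A$, namely $$D^C-(D-A)^C\qquad\text{and}\qquad \mathcal T^{D}-\mathcal T^{D-A},$$ are proportional to the opposite projection $P_{-w}=\mathbb 1\otimes\tau_i-w\,\gamma^*\otimes\tau_j$. -/

import Mathlib

open Bundle
open scoped Manifold ContDiff

noncomputable section

namespace SpinTorsion

/-! ### Twisting by `2 × 2` matrices -/

/-- The modified Pauli matrices `τ₀, τ₁, τ₂, τ₃`. -/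
def tau : Fin 4 → Matrix (Fin 2) (Fin 2) ℂ :=
  ![!![1, 0; 0, 1], !![0, 1; 1, 0], !![0, 1; -1, 0], !![1, 0; 0, -1]]

/-- The endomorphism `f ⊗ m` of `V ⊕ V = V ⊗ ℂ²`. -/
def twist {V : Type*} [AddCommGroup V] [Module ℂ V] (f : Module.End ℂ V)
    (m : Matrix (Fin 2) (Fin 2) ℂ) : Module.End ℂ (V × V) :=
  LinearMap.prod
    (m 0 0 • (f ∘ₗ LinearMap.fst ℂ V V) + m 0 1 • (f ∘ₗ LinearMap.snd ℂ V V))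
    (m 1 0 • (f ∘ₗ LinearMap.fst ℂ V V) + m 1 1 • (f ∘ₗ LinearMap.snd ℂ V V))

section Geometry

variable {E : Type*} [NormedAddCommGroup E] [NormedSpace ℝ E] [FiniteDimensional ℝ E]
  {M : Type*} [TopologicalSpace M] [ChartedSpace E M] [IsManifold 𝓘(ℝ, E) ∞ M]

/-- Differentiability in a point of a section of a vector bundle `V` with fibre `G`. -/
def SectionDiffAt (E : Type*) [NormedAddCommGroup E] [NormedSpace ℝ E]
    {M : Type*} [TopologicalSpace M] [ChartedSpace E M]
    (G : Type*) [NormedAddCommGroup G] [NormedSpace ℝ G]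
    {V : M → Type*} [TopologicalSpace (TotalSpace G V)] [∀ x, TopologicalSpace (V x)]
    [FiberBundle G V] (σ : Π x : M, V x) (x : M) : Prop :=
  MDifferentiableAt 𝓘(ℝ, E) (𝓘(ℝ, E).prod 𝓘(ℝ, G)) (fun p ↦ TotalSpace.mk' G p (σ p)) x

/-! ### The base manifold -/

variable (E M) in
/-- A smooth pseudo-Riemannian metric, of arbitrary signature. -/
structure PseudoRiemannianMetric where
  val (x : M) : TangentSpace 𝓘(ℝ, E) x →L[ℝ] TangentSpace 𝓘(ℝ, E) x →L[ℝ] ℝ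
  symm (x : M) (v w : TangentSpace 𝓘(ℝ, E) x) : val x v w = val x w v
  nondegenerate (x : M) (v : TangentSpace 𝓘(ℝ, E) x) (hv : ∀ w, val x v w = 0) : v = 0
  contMDiff : ContMDiff 𝓘(ℝ, E) (𝓘(ℝ, E).prod 𝓘(ℝ, E →L[ℝ] E →L[ℝ] ℝ)) ∞
    (fun x ↦ TotalSpace.mk' (E →L[ℝ] E →L[ℝ] ℝ) x (val x))

/-- `nabla` is the Levi-Civita connection of `g`: it is metric and torsion free.
Here and below `nabla Y x (X x)` stands for `(∇_X Y)(x)`. -/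
structure IsLeviCivita (g : PseudoRiemannianMetric E M)
    (nabla : CovariantDerivative 𝓘(ℝ, E) E (TangentSpace 𝓘(ℝ, E) : M → Type _)) : Prop where
  torsion_eq_zero : nabla.torsion = 0
  metric : ∀ (x : M) (Y Z : Π x : M, TangentSpace 𝓘(ℝ, E) x),
    SectionDiffAt E E Y x → SectionDiffAt E E Z x → ∀ v : TangentSpace 𝓘(ℝ, E) x,
      mvfderiv 𝓘(ℝ, E) (fun p ↦ g.val p (Y p) (Z p)) x v
        = g.val x (nabla Y x v) (Z x) + g.val x (Y x) (nabla Z x v)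

/-- A pseudo-orthonormal basis of `T_xM`. -/
def IsOrthonormalBasis (g : PseudoRiemannianMetric E M) {x : M} {d : ℕ}
    (e : Module.Basis (Fin d) ℝ (TangentSpace 𝓘(ℝ, E) x)) : Prop :=
  (∀ i j, i ≠ j → g.val x (e i) (e j) = 0) ∧
    ∀ i, g.val x (e i) (e i) = 1 ∨ g.val x (e i) (e i) = -1

/-! ### The spinor bundle -/

variable {F : Type*} [NormedAddCommGroup F] [NormedSpace ℂ F] [FiniteDimensional ℂ F]
  {S : M → Type*} [TopologicalSpace (TotalSpace F S)]
  [∀ x, AddCommGroup (S x)] [∀ x, Module ℂ (S x)] [∀ x, TopologicalSpace (S x)]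
  [∀ x, IsTopologicalAddGroup (S x)] [∀ x, ContinuousSMul ℝ (S x)]
  [FiberBundle F S] [VectorBundle ℝ F S] [ContMDiffVectorBundle ∞ F S 𝓘(ℝ, E)]

variable (F S) in
/-- A Clifford multiplication on the complex vector bundle `S` over a manifold of dimension `2n`,
with the convention `XY + YX = -2 g(X, Y)`. The rank condition says that the Clifford modules
`S_x` are irreducible, so that `S` is a bundle of spinors. -/
structure CliffordMultiplication (n : ℕ) (g : PseudoRiemannianMetric E M) where
  val (x : M) : TangentSpace 𝓘(ℝ, E) x →L[ℝ] S x →L[ℝ] S x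
  map_complex_smul (x : M) (v : TangentSpace 𝓘(ℝ, E) x) (c : ℂ) (ψ : S x) :
    val x v (c • ψ) = c • val x v ψ
  clifford (x : M) (v w : TangentSpace 𝓘(ℝ, E) x) (ψ : S x) :
    val x v (val x w ψ) + val x w (val x v ψ) = (-2 * g.val x v w) • ψ
  finrank_eq : Module.finrank ℂ F = 2 ^ n
  contMDiff : ContMDiff 𝓘(ℝ, E) (𝓘(ℝ, E).prod 𝓘(ℝ, E →L[ℝ] F →L[ℝ] F)) ∞
    (fun x ↦ TotalSpace.mk' (E →L[ℝ] F →L[ℝ] F) x (val x))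

/-- `γ(v)` as a complex linear endomorphism of `S_x`. -/
def CliffordMultiplication.toEnd {n : ℕ} {g : PseudoRiemannianMetric E M}
    (γ : CliffordMultiplication F S n g) (x : M) (v : TangentSpace 𝓘(ℝ, E) x) :
    Module.End ℂ (S x) where
  toFun ψ := γ.val x v ψ
  map_add' ψ φ := map_add _ ψ φ
  map_smul' c ψ := γ.map_complex_smul x v c ψ

/-- The value at `x` of `γ* = γ¹ ⋯ γ²ⁿ` or `i γ¹ ⋯ γ²ⁿ` computed in the pseudo-orthonormal basis
`e`, where `γ^μ = g(e_μ, e_μ) γ(e_μ)`; the factor `i` is absent if and only if the signature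
`2n - 2t` is divisible by `4`, where `t` is the number of time-like vectors of `e`. -/
def chiralityOfBasis {n : ℕ} {g : PseudoRiemannianMetric E M}
    (γ : CliffordMultiplication F S n g) {x : M}
    (e : Module.Basis (Fin (2 * n)) ℝ (TangentSpace 𝓘(ℝ, E) x)) : Module.End ℂ (S x) :=
  (if (4 : ℤ) ∣ 2 * (n : ℤ) - 2 * (Nat.card {i // g.val x (e i) (e i) = -1} : ℤ)
    then (1 : ℂ) else Complex.I) •
  (List.ofFn fun i ↦ ((g.val x (e i) (e i) : ℝ) : ℂ) • γ.toEnd x (e i)).prod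

/-- `γs` is the chirality operator `γ*`. In a point, the values in any two pseudo-orthonormal bases
differ by the sign of the determinant of the change of basis; a choice of sign for which
`γs` is smooth is the same thing as an orientation of `M`. -/
structure IsChiralityOperator {n : ℕ} {g : PseudoRiemannianMetric E M}
    (γ : CliffordMultiplication F S n g) (γs : Π x : M, Module.End ℂ (S x)) : Prop where
  eq_chiralityOfBasis : ∀ x : M, ∃ e : Module.Basis (Fin (2 * n)) ℝ (TangentSpace 𝓘(ℝ, E) x),
    IsOrthonormalBasis g e ∧ γs x = chiralityOfBasis γ e
  contMDiffAt : ∀ (x : M) (ψ : Π x : M, S x),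
    ContMDiffAt 𝓘(ℝ, E) (𝓘(ℝ, E).prod 𝓘(ℝ, F)) ∞ (T% ψ) x →
    ContMDiffAt 𝓘(ℝ, E) (𝓘(ℝ, E).prod 𝓘(ℝ, F)) ∞
      (fun p ↦ TotalSpace.mk' F p (γs p (ψ p))) x

/-- A charge conjugation: a nondegenerate complex bilinear form `C` on `S` such that
`C_0(φ, ψ) = C(φ, ψ)` has the symmetry `Δ₀` and `C_1(φ, ψ)(v) = C(φ, γ(v) ψ)` the
symmetry `Δ₁`. (This implies that it is spin-invariant.) -/
structure ChargeConjugation {n : ℕ} {g : PseudoRiemannianMetric E M}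
    (γ : CliffordMultiplication F S n g) where
  val (x : M) : S x →L[ℝ] S x →L[ℝ] ℂ
  smul_left (x : M) (c : ℂ) (φ ψ : S x) : val x (c • φ) ψ = c * val x φ ψ
  smul_right (x : M) (c : ℂ) (φ ψ : S x) : val x φ (c • ψ) = c * val x φ ψ
  nondegenerate (x : M) (φ : S x) (hφ : ∀ ψ, val x φ ψ = 0) : φ = 0
  Δ₀ : ℤˣ
  Δ₁ : ℤˣ
  symm_zero (x : M) (φ ψ : S x) : val x φ ψ = ((Δ₀ : ℤ) : ℂ) * val x ψ φ
  symm_one (x : M) (v : TangentSpace 𝓘(ℝ, E) x) (φ ψ : S x) :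
    val x φ (γ.val x v ψ) = ((Δ₁ : ℤ) : ℂ) * val x ψ (γ.val x v φ)
  contMDiff : ContMDiff 𝓘(ℝ, E) (𝓘(ℝ, E).prod 𝓘(ℝ, F →L[ℝ] F →L[ℝ] ℂ)) ∞
    (fun x ↦ TotalSpace.mk' (F →L[ℝ] F →L[ℝ] ℂ) x (val x))

/-- `nablaS` is the connection on the spinor bundle induced by the Levi-Civita connection `nabla`:
the unique complex linear connection for which Clifford multiplication and charge conjugation
are parallel. -/
structure IsSpinLeviCivita {n : ℕ} {g : PseudoRiemannianMetric E M}
    {γ : CliffordMultiplication F S n g} (C : ChargeConjugation γ)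
    (nabla : CovariantDerivative 𝓘(ℝ, E) E (TangentSpace 𝓘(ℝ, E) : M → Type _))
    (nablaS : CovariantDerivative 𝓘(ℝ, E) F S) : Prop where
  complex_linear : ∀ (x : M) (ψ : Π x : M, S x), SectionDiffAt E F ψ x →
    ∀ (c : ℂ) (v : TangentSpace 𝓘(ℝ, E) x), nablaS (c • ψ) x v = c • nablaS ψ x v
  clifford_parallel : ∀ (x : M) (Y : Π x : M, TangentSpace 𝓘(ℝ, E) x) (ψ : Π x : M, S x),
    SectionDiffAt E E Y x → SectionDiffAt E F ψ x → ∀ v : TangentSpace 𝓘(ℝ, E) x,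
      nablaS (fun p ↦ γ.val p (Y p) (ψ p)) x v
        = γ.val x (nabla Y x v) (ψ x) + γ.val x (Y x) (nablaS ψ x v)
  charge_parallel : ∀ (x : M) (φ ψ : Π x : M, S x),
    SectionDiffAt E F φ x → SectionDiffAt E F ψ x → ∀ v : TangentSpace 𝓘(ℝ, E) x,
      mvfderiv 𝓘(ℝ, E) (fun p ↦ C.val p (φ p) (ψ p)) x v
        = C.val x (nablaS φ x v) (ψ x) + C.val x (φ x) (nablaS ψ x v)

/-! ### The twisted spinor bundle `S ⊕ S` -/

/-- A section of the direct sum is differentiable in a point iff both components are. -/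
theorem sectionDiffAt_pair_iff {E : Type*} [NormedAddCommGroup E] [NormedSpace ℝ E]
    {M : Type*} [TopologicalSpace M] [ChartedSpace E M]
    {G : Type*} [NormedAddCommGroup G] [NormedSpace ℝ G]
    {V : M → Type*} [TopologicalSpace (TotalSpace G V)] [∀ x, Zero (V x)] [∀ x, TopologicalSpace (V x)]
    [FiberBundle G V] (σ : Π x : M, (V ×ᵇ V) x) (x : M) :
    SectionDiffAt E (G × G) (V := V ×ᵇ V) σ x ↔
      SectionDiffAt E G (V := V) (fun p ↦ (σ p).1) x ∧
      SectionDiffAt E G (V := V) (fun p ↦ (σ p).2) x := by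
  unfold SectionDiffAt
  rw [mdifferentiableAt_section, mdifferentiableAt_section, mdifferentiableAt_section]
  exact mdifferentiableAt_prod_module_iff _

/-- The connection `∇ ⊕ ∇` on `S ⊕ S`. -/
def sumConnection (nablaS : CovariantDerivative 𝓘(ℝ, E) F S) :
    CovariantDerivative 𝓘(ℝ, E) (F × F) (S ×ᵇ S) where
  toFun σ x := (nablaS (fun p ↦ (σ p).1) x).prod (nablaS (fun p ↦ (σ p).2) x)
  isCovariantDerivativeOnUniv := by
    constructor
    · intro σ σ' x hσ hσ' _
      have h := (sectionDiffAt_pair_iff σ x).1 hσ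
      have h' := (sectionDiffAt_pair_iff σ' x).1 hσ'
      ext v
      · exact congrArg (fun L ↦ L v) (nablaS.isCovariantDerivativeOnUniv.add h.1 h'.1)
      · exact congrArg (fun L ↦ L v) (nablaS.isCovariantDerivativeOnUniv.add h.2 h'.2)
    · intro σ f x hσ hf _
      have h := (sectionDiffAt_pair_iff σ x).1 hσ
      ext v
      · exact congrArg (fun L ↦ L v) (nablaS.isCovariantDerivativeOnUniv.leibniz h.1 hf)
      · exact congrArg (fun L ↦ L v) (nablaS.isCovariantDerivativeOnUniv.leibniz h.2 hf)

/-- Clifford multiplication `γ(v) ⊗ 1` on `S ⊕ S`. -/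
def cliffordSum {n : ℕ} {g : PseudoRiemannianMetric E M} (γ : CliffordMultiplication F S n g)
    (x : M) (v : TangentSpace 𝓘(ℝ, E) x) : Module.End ℂ (S x × S x) :=
  twist (γ.toEnd x v) 1

/-- The charge conjugation `C ⊗ τ_k` on `S ⊕ S`, that is
`(C ⊗ τ_k)(φ, ψ) = (C ⊕ C)(φ, (1 ⊗ τ_k) ψ)`. For `k = 0` it is `C ⊕ C`. -/
def chargeSum {n : ℕ} {g : PseudoRiemannianMetric E M} {γ : CliffordMultiplication F S n g}
    (C : ChargeConjugation γ) (k : Fin 4) (x : M) (φ ψ : S x × S x) : ℂ :=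
  C.val x φ.1 (twist 1 (tau k) ψ).1 + C.val x φ.2 (twist 1 (tau k) ψ).2

/-- The operator `1 ⊗ τ_i + w γ* ⊗ τ_j`, for a sign `w`. -/
def chiralProjection (γs : Π x : M, Module.End ℂ (S x)) (i j : Fin 4) (w : ℤˣ) (x : M) :
    Module.End ℂ (S x × S x) :=
  twist 1 (tau i) + ((w : ℤ) : ℂ) • twist (γs x) (tau j)

/-- Connections on the real vector bundle underlying `S ⊕ S`. -/
abbrev SumConnection (E F : Type*) [NormedAddCommGroup E] [NormedSpace ℝ E]
    [NormedAddCommGroup F] [NormedSpace ℂ F]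
    {M : Type*} [TopologicalSpace M] [ChartedSpace E M]
    (S : M → Type*) [TopologicalSpace (TotalSpace F S)]
    [∀ x, AddCommGroup (S x)] [∀ x, Module ℂ (S x)] [∀ x, TopologicalSpace (S x)]
    [∀ x, IsTopologicalAddGroup (S x)] [∀ x, ContinuousSMul ℝ (S x)] [FiberBundle F S] :=
  CovariantDerivative 𝓘(ℝ, E) (F × F) (S ×ᵇ S)

/-- `D` is a connection on the complex vector bundle `S ⊕ S`. -/
def IsComplexLinear (D : SumConnection E F S) : Prop :=
  ∀ (x : M) (ψ : Π x : M, (S ×ᵇ S) x), SectionDiffAt E (F × F) (V := S ×ᵇ S) ψ x →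
    ∀ (c : ℂ) (v : TangentSpace 𝓘(ℝ, E) x), D (fun p ↦ c • ψ p) x v = c • D ψ x v

/-- `DC` is the connection `D^C` associated with `D` and the charge conjugation `C ⊗ τ_k`, which
is characterized by `(D ⊗ 1 + 1 ⊗ D^C) (C ⊗ τ_k) = 0`. -/
def IsConjugateConnection {n : ℕ} {g : PseudoRiemannianMetric E M}
    {γ : CliffordMultiplication F S n g} (C : ChargeConjugation γ) (k : Fin 4)
    (D DC : SumConnection E F S) : Prop :=
  ∀ (x : M) (φ ψ : Π x : M, (S ×ᵇ S) x), SectionDiffAt E (F × F) (V := S ×ᵇ S) φ x →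
    SectionDiffAt E (F × F) (V := S ×ᵇ S) ψ x → ∀ v : TangentSpace 𝓘(ℝ, E) x,
      mvfderiv 𝓘(ℝ, E) (fun p ↦ chargeSum C k p (φ p) (ψ p)) x v
        = chargeSum C k x (D φ x v) (ψ x) + chargeSum C k x (φ x) (DC ψ x v)

/-- `(D̂_Z γ)(X) ξ = D_Z (γ(X) ξ) - γ(∇_Z X) ξ - γ(X) D^C_Z ξ`. -/
def hatD {n : ℕ} {g : PseudoRiemannianMetric E M} (γ : CliffordMultiplication F S n g)
    (nabla : CovariantDerivative 𝓘(ℝ, E) E (TangentSpace 𝓘(ℝ, E) : M → Type _))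
    (D DC : SumConnection E F S) (Z X : Π x : M, TangentSpace 𝓘(ℝ, E) x)
    (ξ : Π x : M, (S ×ᵇ S) x) (x : M) : S x × S x :=
  D (fun p ↦ cliffordSum γ p (X p) (ξ p)) x (Z x)
    - cliffordSum γ x (nabla X x (Z x)) (ξ x)
    - cliffordSum γ x (X x) (DC ξ x (Z x))

/-- The torsion `T(X, Y) ξ` of `D`: two times the skew symmetrization of `D̂γ`. -/
def spinTorsion {n : ℕ} {g : PseudoRiemannianMetric E M} (γ : CliffordMultiplication F S n g)
    (nabla : CovariantDerivative 𝓘(ℝ, E) E (TangentSpace 𝓘(ℝ, E) : M → Type _))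
    (D DC : SumConnection E F S) (X Y : Π x : M, TangentSpace 𝓘(ℝ, E) x)
    (ξ : Π x : M, (S ×ᵇ S) x) (x : M) : S x × S x :=
  hatD γ nabla D DC X Y ξ x - hatD γ nabla D DC Y X ξ x

/-- `D` is admissible: `D̂γ` is skew symmetric. -/
def IsAdmissible {n : ℕ} {g : PseudoRiemannianMetric E M} {γ : CliffordMultiplication F S n g}
    (C : ChargeConjugation γ) (k : Fin 4)
    (nabla : CovariantDerivative 𝓘(ℝ, E) E (TangentSpace 𝓘(ℝ, E) : M → Type _))
    (D : SumConnection E F S) : Prop :=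
  ∃ DC : SumConnection E F S, IsConjugateConnection C k D DC ∧
    ∀ (x : M) (X Y : Π x : M, TangentSpace 𝓘(ℝ, E) x) (ξ : Π x : M, (S ×ᵇ S) x),
      SectionDiffAt E E X x → SectionDiffAt E E Y x →
      SectionDiffAt E (F × F) (V := S ×ᵇ S) ξ x →
      hatD γ nabla D DC X Y ξ x = - hatD γ nabla D DC Y X ξ x

/-- The `End(S ⊕ S)`-valued one-form `A` is proportional to `P`: it is `A_v = (B_v ⊗ 1) P` for a
one-form `B` with values in `End(S)`. -/
def IsProportionalOneForm
    (A : Π x : M, (S ×ᵇ S) x →L[ℝ] TangentSpace 𝓘(ℝ, E) x →L[ℝ] (S ×ᵇ S) x)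
    (P : Π x : M, Module.End ℂ (S x × S x)) : Prop :=
  ∃ B : Π x : M, TangentSpace 𝓘(ℝ, E) x →ₗ[ℝ] Module.End ℂ (S x),
    ∀ (x : M) (v : TangentSpace 𝓘(ℝ, E) x) (ψ : S x × S x), A x ψ v = twist (B x v) 1 (P x ψ)

/-- The tensor `T`, given by its values `T(X, Y) ξ` on vector fields and sections, is proportional
to `P`: it is `T(X, Y) = (B(X, Y) ⊗ 1) P` for a two-form `B` with values in `End(S)`. -/
def IsProportionalTwoForm
    (T : (Π x : M, TangentSpace 𝓘(ℝ, E) x) → (Π x : M, TangentSpace 𝓘(ℝ, E) x) →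
      (Π x : M, (S ×ᵇ S) x) → Π x : M, S x × S x)
    (P : Π x : M, Module.End ℂ (S x × S x)) : Prop :=
  ∃ B : Π x : M, TangentSpace 𝓘(ℝ, E) x →ₗ[ℝ] TangentSpace 𝓘(ℝ, E) x →ₗ[ℝ] Module.End ℂ (S x),
    (∀ (x : M) (v : TangentSpace 𝓘(ℝ, E) x), B x v v = 0) ∧
    ∀ (x : M) (X Y : Π x : M, TangentSpace 𝓘(ℝ, E) x) (ξ : Π x : M, (S ×ᵇ S) x),
      SectionDiffAt E E X x → SectionDiffAt E E Y x →
      SectionDiffAt E (F × F) (V := S ×ᵇ S) ξ x →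
      T X Y ξ x = twist (B x (X x) (Y x)) 1 (P x (ξ x))

end Geometry

end SpinTorsion

end

/-!
Clifford multiplication anticommutes with `γ*`, so it exchanges the two operators:
`P_w (γ(v) ⊗ 1) = (γ(v) ⊗ 1) P_{-w}`. Let `a` be the contribution of `A` to `D^C`; it depends on `A`
alone, because the charge conjugation is nondegenerate. Since `∇γ = 0` and `∇^C = ∇`, admissibility
of `∇ + A` says that `A_u γ(v) - γ(v) a_u` is skew symmetric in `u` and `v`, in particular
`γ(v) a_v = A_v γ(v) = (B_v γ(v) ⊗ 1) P_{-w}`. For `v` non-isotropic, `γ(v)` is invertible and so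
`a_v` is proportional to `P_{-w}`; there is a basis of non-isotropic vectors, hence `a` is
proportional to `P_{-w}`. The contribution of `A` to the torsion is twice the skew symmetrization
of `A_u γ(v) - γ(v) a_u`, where both terms are now proportional to `P_{-w}`.
-/

namespace SpinTorsion

section Twist

variable {V : Type*} [AddCommGroup V] [Module ℂ V]

@[simp]
theorem twist_apply (f : Module.End ℂ V) (m : Matrix (Fin 2) (Fin 2) ℂ) (ψ : V × V) :
    twist f m ψ = (m 0 0 • f ψ.1 + m 0 1 • f ψ.2, m 1 0 • f ψ.1 + m 1 1 • f ψ.2) :=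
  rfl

theorem twist_one_apply (f : Module.End ℂ V) (ψ : V × V) : twist f 1 ψ = (f ψ.1, f ψ.2) := by
  simp

theorem twist_mul_twist (f h : Module.End ℂ V) (m p : Matrix (Fin 2) (Fin 2) ℂ) :
    twist f m * twist h p = twist (f * h) (m * p) := by
  ext <;> simp [Matrix.mul_apply, Fin.sum_univ_two] <;> module

theorem twist_mul (f h : Module.End ℂ V) : twist (f * h) 1 = twist f 1 * twist h 1 := by
  rw [twist_mul_twist, one_mul]

theorem twist_neg_left (f : Module.End ℂ V) (m : Matrix (Fin 2) (Fin 2) ℂ) :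
    twist (-f) m = -twist f m := by
  ext <;> simp

theorem twist_sub_left (f h : Module.End ℂ V) (m : Matrix (Fin 2) (Fin 2) ℂ) :
    twist (f - h) m = twist f m - twist h m := by
  ext <;> simp [smul_sub]

theorem twist_one_one : twist (1 : Module.End ℂ V) 1 = 1 := by
  ext <;> simp

theorem semiconjBy_twist {c f h : Module.End ℂ V} (hc : SemiconjBy c f h)
    (m : Matrix (Fin 2) (Fin 2) ℂ) : SemiconjBy (twist c 1) (twist f m) (twist h m) := by
  rw [SemiconjBy, twist_mul_twist, twist_mul_twist, hc.eq, one_mul, mul_one]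

theorem tau_isUnit (k : Fin 4) : IsUnit (tau k) := by
  rw [Matrix.isUnit_iff_isUnit_det, Matrix.det_fin_two]
  fin_cases k <;> simp [tau]

theorem twist_injective {m : Matrix (Fin 2) (Fin 2) ℂ} (hm : IsUnit m) :
    Function.Injective (twist (1 : Module.End ℂ V) m) := by
  obtain ⟨m, rfl⟩ := hm
  refine Function.LeftInverse.injective (g := twist 1 (↑m⁻¹)) fun ψ ↦ ?_
  rw [← Module.End.mul_apply, twist_mul_twist, Units.inv_mul, one_mul, twist_one_one,
    Module.End.one_apply]

theorem eq_twist_of_semiconjBy {c c' : Module.End ℂ V} (hc : c' * c = 1)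
    {P Q : Module.End ℂ (V × V)} (hPQ : SemiconjBy (twist c 1) Q P) (b : Module.End ℂ V)
    {φ ψ : V × V} (h : twist b 1 (P (twist c 1 ψ)) = twist c 1 φ) :
    φ = twist (c' * b * c) 1 (Q ψ) := by
  have hψ : P (twist c 1 ψ) = twist c 1 (Q ψ) := (LinearMap.congr_fun hPQ.eq ψ).symm
  rw [twist_mul, twist_mul, Module.End.mul_apply, Module.End.mul_apply, ← hψ, h,
    ← Module.End.mul_apply, ← twist_mul, hc, twist_one_one, Module.End.one_apply]

theorem exists_eq_twist_of_basis {T ι : Type*} [AddCommGroup T] [Module ℝ T]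
    (e : Module.Basis ι ℝ T) (Q : Module.End ℂ (V × V)) (a : V × V → T →ₗ[ℝ] V × V)
    (h : ∀ l, ∃ b : Module.End ℂ V, ∀ ψ, a ψ (e l) = twist b 1 (Q ψ)) :
    ∃ B : T →ₗ[ℝ] Module.End ℂ V, ∀ v ψ, a ψ v = twist (B v) 1 (Q ψ) := by
  choose b hb using h
  refine ⟨e.constr ℝ b, fun v ψ ↦ ?_⟩
  let evalTwist : Module.End ℂ V →ₗ[ℝ] V × V :=
    ((LinearMap.applyₗ (Q ψ).1).prod (LinearMap.applyₗ (Q ψ).2)).restrictScalars ℝ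
  have hev (f : Module.End ℂ V) : twist f 1 (Q ψ) = evalTwist f := twist_one_apply f _
  have hext : a ψ = evalTwist ∘ₗ e.constr ℝ b := e.ext fun l ↦ by
    rw [LinearMap.comp_apply, e.constr_basis, ← hev, hb]
  rw [hev, hext, LinearMap.comp_apply]

end Twist

theorem mul_prod_ofFn_of_forall_mul_eq_smul {K R : Type*} [CommSemiring K] [Semiring R]
    [Algebra K R] (x : R) {m : ℕ} (f : Fin m → R) (ε : Fin m → K)
    (h : ∀ j, x * f j = ε j • (f j * x)) :
    x * (List.ofFn f).prod = (∏ j, ε j) • ((List.ofFn f).prod * x) := by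
  induction m with
  | zero => simp
  | succ m ih =>
    rw [List.ofFn_succ, List.prod_cons, ← mul_assoc, h 0, smul_mul_assoc, mul_assoc,
      ih (fun j ↦ f j.succ) (fun j ↦ ε j.succ) fun j ↦ h j.succ, mul_smul_comm, smul_smul,
      ← Fin.prod_univ_succ, ← mul_assoc]

section Clifford

variable {E : Type*} [NormedAddCommGroup E] [NormedSpace ℝ E]
  {M : Type*} [TopologicalSpace M] [ChartedSpace E M] [IsManifold 𝓘(ℝ, E) ∞ M]
  {F : Type*} [NormedAddCommGroup F] [NormedSpace ℂ F]
  {S : M → Type*} [TopologicalSpace (TotalSpace F S)]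
  [∀ x, AddCommGroup (S x)] [∀ x, Module ℂ (S x)] [∀ x, TopologicalSpace (S x)]
  [∀ x, IsTopologicalAddGroup (S x)] [∀ x, ContinuousSMul ℝ (S x)]
  [FiberBundle F S] [VectorBundle ℝ F S]
  {n : ℕ} {g : PseudoRiemannianMetric E M} (γ : CliffordMultiplication F S n g)
  {x : M}

namespace CliffordMultiplication

/-- Clifford multiplication `v ↦ γ(v)` as a real linear map into the complex endomorphisms. -/
noncomputable def toEndₗ (x : M) : TangentSpace 𝓘(ℝ, E) x →ₗ[ℝ] Module.End ℂ (S x) where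
  toFun v := γ.toEnd x v
  map_add' v w := by
    ext ψ
    change γ.val x (v + w) ψ = γ.val x v ψ + γ.val x w ψ
    rw [map_add, add_apply]
  map_smul' c v := by
    ext ψ
    change γ.val x (c • v) ψ = c • γ.val x v ψ
    rw [map_smul, smul_apply]

theorem toEnd_mul_add_mul (v w : TangentSpace 𝓘(ℝ, E) x) :
    γ.toEnd x v * γ.toEnd x w + γ.toEnd x w * γ.toEnd x v
      = (-2 * g.val x v w) • (1 : Module.End ℂ (S x)) :=
  LinearMap.ext (γ.clifford x v w)

theorem toEnd_mul_self (v : TangentSpace 𝓘(ℝ, E) x) :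
    γ.toEnd x v * γ.toEnd x v = (-g.val x v v) • (1 : Module.End ℂ (S x)) := by
  have h := γ.toEnd_mul_add_mul v v
  rw [neg_mul, ← mul_neg, mul_smul, ← two_smul ℝ] at h
  exact smul_right_injective _ two_ne_zero h

theorem toEnd_mul_eq_neg_mul {v w : TangentSpace 𝓘(ℝ, E) x} (hvw : g.val x v w = 0) :
    γ.toEnd x v * γ.toEnd x w = -(γ.toEnd x w * γ.toEnd x v) := by
  rw [eq_neg_iff_add_eq_zero, toEnd_mul_add_mul, hvw, mul_zero, zero_smul]

theorem exists_mul_toEnd_eq_one {v : TangentSpace 𝓘(ℝ, E) x} (hv : g.val x v v ≠ 0) :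
    ∃ c : Module.End ℂ (S x), c * γ.toEnd x v = 1 :=
  ⟨(-g.val x v v)⁻¹ • γ.toEnd x v, by
    rw [smul_mul_assoc, toEnd_mul_self, inv_smul_smul₀ (neg_ne_zero.2 hv)]⟩

end CliffordMultiplication

theorem PseudoRiemannianMetric.exists_basis_forall_self_ne_zero [FiniteDimensional ℝ E]
    (g : PseudoRiemannianMetric E M) (x : M) :
    ∃ e : Module.Basis (Fin (Module.finrank ℝ E)) ℝ (TangentSpace 𝓘(ℝ, E) x),
      ∀ l, g.val x (e l) (e l) ≠ 0 := by
  have : FiniteDimensional ℝ (TangentSpace 𝓘(ℝ, E) x) := inferInstanceAs (FiniteDimensional ℝ E)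
  obtain ⟨e, he⟩ := LinearMap.BilinForm.exists_orthogonal_basis
    (B := (g.val x).toLinearMap₁₂) ⟨g.symm x⟩
  exact ⟨e, he.not_isOrtho_basis_self_of_separatingLeft (g.nondegenerate x)⟩

theorem toEnd_mul_chiralityOfBasis
    {e : Module.Basis (Fin (2 * n)) ℝ (TangentSpace 𝓘(ℝ, E) x)}
    (he : ∀ i j, i ≠ j → g.val x (e i) (e j) = 0)
    (l : Fin (2 * n)) :
    γ.toEnd x (e l) * chiralityOfBasis γ e = -(chiralityOfBasis γ e * γ.toEnd x (e l)) := by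
  have hprod : ∏ j : Fin (2 * n), (if j = l then (1 : ℂ) else -1) = -1 := by
    rw [Finset.prod_ite, Finset.prod_const_one, one_mul, Finset.prod_const,
      Finset.filter_ne', Finset.card_erase_of_mem (Finset.mem_univ l), Finset.card_univ,
      Fintype.card_fin]
    exact Odd.neg_one_pow ⟨n - 1, by have := l.pos; omega⟩
  -- `γ(e_l)` commutes with its own factor and anticommutes with the `2n - 1` others
  rw [chiralityOfBasis, mul_smul_comm, mul_prod_ofFn_of_forall_mul_eq_smul _ _
    (fun j ↦ if j = l then (1 : ℂ) else -1), hprod, neg_one_smul, smul_neg, smul_mul_assoc]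
  intro j
  rw [mul_smul_comm, smul_mul_assoc, smul_comm]
  congr 1
  split_ifs with hj
  · rw [hj, one_smul]
  · rw [γ.toEnd_mul_eq_neg_mul (he l j (Ne.symm hj)), neg_one_smul]

theorem IsChiralityOperator.semiconjBy_toEnd {γs : Π x : M, Module.End ℂ (S x)}
    (hγs : IsChiralityOperator γ γs) (x : M) (v : TangentSpace 𝓘(ℝ, E) x) :
    SemiconjBy (γ.toEnd x v) (γs x) (-γs x) := by
  obtain ⟨e, he, hγ⟩ := hγs.eq_chiralityOfBasis x
  have hext : LinearMap.mulRight ℝ (γs x) ∘ₗ γ.toEndₗ x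
      = LinearMap.mulLeft ℝ (-γs x) ∘ₗ γ.toEndₗ x := e.ext fun l ↦ by
    rw [hγ]
    exact (toEnd_mul_chiralityOfBasis γ he.1 l).trans (neg_mul _ _).symm
  exact LinearMap.congr_fun hext v

theorem IsChiralityOperator.semiconjBy_chiralProjection {γs : Π x : M, Module.End ℂ (S x)}
    (hγs : IsChiralityOperator γ γs) (i j : Fin 4) (w : ℤˣ) (x : M)
    (v : TangentSpace 𝓘(ℝ, E) x) :
    SemiconjBy (cliffordSum γ x v) (chiralProjection γs i j (-w) x)
      (chiralProjection γs i j w x) := by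
  have htwist := (semiconjBy_twist (hγs.semiconjBy_toEnd γ x v) (tau j)).smul_right
    (((-w : ℤˣ) : ℤ) : ℂ)
  have hsign : (((-w : ℤˣ) : ℤ) : ℂ) • twist (-γs x) (tau j)
      = ((w : ℤ) : ℂ) • twist (γs x) (tau j) := by
    rw [twist_neg_left, Units.val_neg, Int.cast_neg, neg_smul_neg]
  rw [hsign] at htwist
  exact (semiconjBy_twist (SemiconjBy.one_right _) _).add_right htwist

end Clifford

section Sections

variable {E : Type*} [NormedAddCommGroup E] [NormedSpace ℝ E]
  {M : Type*} [TopologicalSpace M] [ChartedSpace E M] {x : M}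

theorem exists_sectionDiffAt_eq {G : Type*} [NormedAddCommGroup G] [NormedSpace ℝ G]
    {V : M → Type*} [TopologicalSpace (TotalSpace G V)] [∀ x, AddCommGroup (V x)]
    [∀ x, TopologicalSpace (V x)] [FiberBundle G V] (v : V x) :
    ∃ σ : Π x : M, V x, SectionDiffAt E G σ x ∧ σ x = v :=
  ⟨FiberBundle.extend G v, FiberBundle.mdifferentiableAt_extend .., by simp⟩

theorem SectionDiffAt.complex_smul {F : Type*} [NormedAddCommGroup F] [NormedSpace ℂ F]
    {S : M → Type*} [TopologicalSpace (TotalSpace F S)] [∀ x, AddCommGroup (S x)]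
    [∀ x, Module ℂ (S x)] [∀ x, TopologicalSpace (S x)] [FiberBundle F S] [VectorBundle ℂ F S]
    (c : ℂ) {ψ : Π x : M, S x} (hψ : SectionDiffAt E F ψ x) : SectionDiffAt E F (c • ψ) x := by
  unfold SectionDiffAt at *
  rw [mdifferentiableAt_section] at *
  have h : MDifferentiableAt 𝓘(ℝ, E) 𝓘(ℝ, F)
      (fun p ↦ c • (trivializationAt F S x ⟨p, ψ p⟩).2) x :=
    ((c • ContinuousLinearMap.id ℂ F).restrictScalars ℝ).differentiableAt.mdifferentiableAt.comp
      x hψ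
  refine h.congr_of_eventuallyEq ?_
  filter_upwards [(trivializationAt F S x).open_baseSet.mem_nhds
    (FiberBundle.mem_baseSet_trivializationAt' x)] with p hp
  exact ((trivializationAt F S x).linear ℂ hp).2 c (ψ p)

theorem sectionDiffAt_twist_one {F : Type*} [NormedAddCommGroup F] [NormedSpace ℂ F]
    {S : M → Type*} [TopologicalSpace (TotalSpace F S)] [∀ x, AddCommGroup (S x)]
    [∀ x, Module ℂ (S x)] [∀ x, TopologicalSpace (S x)] [FiberBundle F S] [VectorBundle ℂ F S]
    [VectorBundle ℝ F S] (m : Matrix (Fin 2) (Fin 2) ℂ)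
    {ψ : Π x : M, (S ×ᵇ S) x} (hψ : SectionDiffAt E (F × F) (V := S ×ᵇ S) ψ x) :
    SectionDiffAt E (F × F) (V := S ×ᵇ S) (fun p ↦ twist 1 m (ψ p : S p × S p)) x := by
  obtain ⟨hψ₁, hψ₂⟩ := (sectionDiffAt_pair_iff ψ x).1 hψ
  exact (sectionDiffAt_pair_iff _ x).2
    ⟨mdifferentiableAt_add_section (hψ₁.complex_smul _) (hψ₂.complex_smul _),
      mdifferentiableAt_add_section (hψ₁.complex_smul _) (hψ₂.complex_smul _)⟩

theorem addOneForm_apply {G : Type*} [NormedAddCommGroup G] [NormedSpace ℝ G]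
    {V : M → Type*} [TopologicalSpace (TotalSpace G V)] [∀ x, AddCommGroup (V x)]
    [∀ x, Module ℝ (V x)] [∀ x, TopologicalSpace (V x)] [∀ x, IsTopologicalAddGroup (V x)]
    [∀ x, ContinuousSMul ℝ (V x)] [FiberBundle G V] (D : CovariantDerivative 𝓘(ℝ, E) G V)
    (A : Π x : M, V x →L[ℝ] TangentSpace 𝓘(ℝ, E) x →L[ℝ] V x)
    (σ : Π x : M, V x) (x : M) (v : TangentSpace 𝓘(ℝ, E) x) :
    D.addOneForm A σ x v = D σ x v + A x (σ x) v :=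
  rfl

theorem addOneForm_neg_addOneForm {G : Type*} [NormedAddCommGroup G] [NormedSpace ℝ G]
    {V : M → Type*} [TopologicalSpace (TotalSpace G V)] [∀ x, AddCommGroup (V x)]
    [∀ x, Module ℝ (V x)] [∀ x, TopologicalSpace (V x)] [∀ x, IsTopologicalAddGroup (V x)]
    [∀ x, ContinuousSMul ℝ (V x)] [FiberBundle G V] (D : CovariantDerivative 𝓘(ℝ, E) G V)
    (A : Π x : M, V x →L[ℝ] TangentSpace 𝓘(ℝ, E) x →L[ℝ] V x) :
    (D.addOneForm fun x ↦ -A x).addOneForm A = D := by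
  ext σ x v
  rw [addOneForm_apply, addOneForm_apply, neg_apply, neg_apply, neg_add_cancel_right]

theorem difference_apply {G : Type*} [NormedAddCommGroup G] [NormedSpace ℝ G]
    [FiniteDimensional ℝ G]
    {V : M → Type*} [TopologicalSpace (TotalSpace G V)] [∀ x, AddCommGroup (V x)]
    [∀ x, Module ℝ (V x)] [∀ x, TopologicalSpace (V x)] [∀ x, IsTopologicalAddGroup (V x)]
    [∀ x, ContinuousSMul ℝ (V x)] [FiberBundle G V] [VectorBundle ℝ G V]
    [ContMDiffVectorBundle 1 G V 𝓘(ℝ, E)] (D D' : CovariantDerivative 𝓘(ℝ, E) G V)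
    {σ : Π x : M, V x} (hσ : SectionDiffAt E G σ x) (v : TangentSpace 𝓘(ℝ, E) x) :
    D.difference D' x (σ x) v = D σ x v - D' σ x v :=
  congrArg (fun L ↦ L v) (D.isCovariantDerivativeOnUniv.difference_apply
    D'.isCovariantDerivativeOnUniv (x := x) (Set.mem_univ x) hσ)

end Sections

section Charge

variable {E : Type*} [NormedAddCommGroup E] [NormedSpace ℝ E]
  {M : Type*} [TopologicalSpace M] [ChartedSpace E M] [IsManifold 𝓘(ℝ, E) ∞ M]
  {F : Type*} [NormedAddCommGroup F] [NormedSpace ℂ F]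
  {S : M → Type*} [TopologicalSpace (TotalSpace F S)]
  [∀ x, AddCommGroup (S x)] [∀ x, Module ℂ (S x)] [∀ x, TopologicalSpace (S x)]
  [∀ x, IsTopologicalAddGroup (S x)] [∀ x, ContinuousSMul ℝ (S x)]
  [FiberBundle F S] [VectorBundle ℝ F S]
  {n : ℕ} {g : PseudoRiemannianMetric E M} {γ : CliffordMultiplication F S n g}
  (C : ChargeConjugation γ) (k : Fin 4) {x : M}

theorem ChargeConjugation.mdifferentiableAt {φ ψ : Π x : M, S x}
    (hφ : SectionDiffAt E F φ x) (hψ : SectionDiffAt E F ψ x) :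
    MDifferentiableAt 𝓘(ℝ, E) 𝓘(ℝ, ℂ) (fun p ↦ C.val p (φ p) (ψ p)) x := by
  have h := (C.contMDiff.mdifferentiable (by simp) x).clm_bundle_apply₂ (F₁ := F) (F₂ := F)
    (F₃ := ℂ) (E₃ := Trivial M ℂ) hφ hψ
  simpa [mdifferentiableAt_section] using h

theorem chargeSum_add_left (φ φ' ψ : S x × S x) :
    chargeSum C k x (φ + φ') ψ = chargeSum C k x φ ψ + chargeSum C k x φ' ψ := by
  simp only [chargeSum, Prod.fst_add, Prod.snd_add, map_add, add_apply]
  ring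

theorem chargeSum_sub_right (φ ψ ψ' : S x × S x) :
    chargeSum C k x φ (ψ - ψ') = chargeSum C k x φ ψ - chargeSum C k x φ ψ' := by
  simp only [chargeSum, map_sub, Prod.fst_sub, Prod.snd_sub]
  ring

theorem ChargeConjugation.eq_zero_of_forall_left {C : ChargeConjugation γ} {ψ : S x}
    (h : ∀ φ, C.val x φ ψ = 0) : ψ = 0 :=
  C.nondegenerate x ψ fun φ ↦ by rw [C.symm_zero, h, mul_zero]

variable {C k} in
theorem eq_zero_of_forall_chargeSum {ψ : S x × S x}
    (h : ∀ φ, chargeSum C k x φ ψ = 0) : ψ = 0 := by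
  refine (map_eq_zero_iff _ (twist_injective (tau_isUnit k))).1 (Prod.ext ?_ ?_)
  · exact C.eq_zero_of_forall_left fun φ ↦ by simpa [chargeSum] using h (φ, 0)
  · exact C.eq_zero_of_forall_left fun φ ↦ by simpa [chargeSum] using h (0, φ)

/-- `AC` is the contribution to `D^C` of a contribution `A` to `D`, characterized by
`(A ⊗ 1 + 1 ⊗ AC) (C ⊗ τ_k) = 0`. -/
def IsConjugateOneForm
    (A AC : Π x : M, (S ×ᵇ S) x →L[ℝ] TangentSpace 𝓘(ℝ, E) x →L[ℝ] (S ×ᵇ S) x) : Prop :=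
  ∀ (x : M) (φ ψ : S x × S x) (v : TangentSpace 𝓘(ℝ, E) x),
    chargeSum C k x (A x φ v) ψ + chargeSum C k x φ (AC x ψ v) = 0

variable {C k} in
theorem IsConjugateOneForm.unique
    {A AC AC' : Π x : M, (S ×ᵇ S) x →L[ℝ] TangentSpace 𝓘(ℝ, E) x →L[ℝ] (S ×ᵇ S) x}
    (h : IsConjugateOneForm C k A AC) (h' : IsConjugateOneForm C k A AC') : AC = AC' := by
  refine funext fun x ↦ ContinuousLinearMap.ext fun ψ ↦ ContinuousLinearMap.ext fun v ↦ ?_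
  refine sub_eq_zero.1 (eq_zero_of_forall_chargeSum (C := C) (k := k) fun φ ↦ ?_)
  rw [chargeSum_sub_right]
  linear_combination h x φ ψ v - h' x φ ψ v

end Charge

section Connections

variable {E : Type*} [NormedAddCommGroup E] [NormedSpace ℝ E]
  {M : Type*} [TopologicalSpace M] [ChartedSpace E M] [IsManifold 𝓘(ℝ, E) ∞ M]
  {F : Type*} [NormedAddCommGroup F] [NormedSpace ℂ F]
  {S : M → Type*} [TopologicalSpace (TotalSpace F S)]
  [∀ x, AddCommGroup (S x)] [∀ x, Module ℂ (S x)] [∀ x, TopologicalSpace (S x)]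
  [∀ x, IsTopologicalAddGroup (S x)] [∀ x, ContinuousSMul ℝ (S x)]
  [FiberBundle F S] [VectorBundle ℝ F S]
  {n : ℕ} {g : PseudoRiemannianMetric E M} {γ : CliffordMultiplication F S n g}
  {C : ChargeConjugation γ} {k : Fin 4} {x : M}
  {nabla : CovariantDerivative 𝓘(ℝ, E) E (TangentSpace 𝓘(ℝ, E) : M → Type _)}
  {nablaS : CovariantDerivative 𝓘(ℝ, E) F S}

theorem cliffordSum_apply (v : TangentSpace 𝓘(ℝ, E) x) (ψ : S x × S x) :
    cliffordSum γ x v ψ = (γ.val x v ψ.1, γ.val x v ψ.2) :=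
  twist_one_apply _ _

theorem IsSpinLeviCivita.apply_smul_add_smul [VectorBundle ℂ F S]
    (h : IsSpinLeviCivita C nabla nablaS)
    {ψ ψ' : Π x : M, S x} (hψ : SectionDiffAt E F ψ x) (hψ' : SectionDiffAt E F ψ' x) (a b : ℂ)
    (v : TangentSpace 𝓘(ℝ, E) x) :
    nablaS (a • ψ + b • ψ') x v = a • nablaS ψ x v + b • nablaS ψ' x v := by
  rw [nablaS.isCovariantDerivativeOnUniv.add (hψ.complex_smul a) (hψ'.complex_smul b), add_apply,
    h.complex_linear x _ hψ, h.complex_linear x _ hψ']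

theorem IsSpinLeviCivita.sumConnection_twist_one [VectorBundle ℂ F S]
    (h : IsSpinLeviCivita C nabla nablaS) (m : Matrix (Fin 2) (Fin 2) ℂ)
    {ψ : Π x : M, (S ×ᵇ S) x} (hψ : SectionDiffAt E (F × F) (V := S ×ᵇ S) ψ x)
    (v : TangentSpace 𝓘(ℝ, E) x) :
    sumConnection (F := F) nablaS (fun p ↦ twist 1 m (ψ p : S p × S p)) x v
      = twist 1 m (sumConnection (F := F) nablaS ψ x v : S x × S x) := by
  obtain ⟨hψ₁, hψ₂⟩ := (sectionDiffAt_pair_iff ψ x).1 hψ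
  exact Prod.ext (h.apply_smul_add_smul hψ₁ hψ₂ _ _ v) (h.apply_smul_add_smul hψ₁ hψ₂ _ _ v)

theorem IsSpinLeviCivita.isConjugateConnection_sumConnection [VectorBundle ℂ F S]
    (h : IsSpinLeviCivita C nabla nablaS) (k : Fin 4) :
    IsConjugateConnection C k (sumConnection (F := F) nablaS)
      (sumConnection (F := F) nablaS) := by
  intro x φ ψ hφ hψ v
  obtain ⟨hφ₁, hφ₂⟩ := (sectionDiffAt_pair_iff φ x).1 hφ
  have hτψ := sectionDiffAt_twist_one (tau k) hψ
  obtain ⟨hψ₁, hψ₂⟩ := (sectionDiffAt_pair_iff _ x).1 hτψ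
  have hleibniz := congrArg (fun L ↦ L v)
    (mvfderiv_fun_add (C.mdifferentiableAt hφ₁ hψ₁) (C.mdifferentiableAt hφ₂ hψ₂))
  rw [add_apply, h.charge_parallel x _ _ hφ₁ hψ₁ v, h.charge_parallel x _ _ hφ₂ hψ₂ v,
    add_add_add_comm] at hleibniz
  simp only [chargeSum]
  rw [← h.sumConnection_twist_one (tau k) hψ v]
  exact hleibniz

theorem IsSpinLeviCivita.sumConnection_cliffordSum (h : IsSpinLeviCivita C nabla nablaS)
    {Y : Π x : M, TangentSpace 𝓘(ℝ, E) x} {ψ : Π x : M, (S ×ᵇ S) x} (hY : SectionDiffAt E E Y x)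
    (hψ : SectionDiffAt E (F × F) (V := S ×ᵇ S) ψ x) (v : TangentSpace 𝓘(ℝ, E) x) :
    sumConnection (F := F) nablaS (fun p ↦ cliffordSum γ p (Y p) (ψ p)) x v
      = cliffordSum γ x (nabla Y x v) (ψ x)
        + cliffordSum γ x (Y x) (sumConnection (F := F) nablaS ψ x v) := by
  obtain ⟨hψ₁, hψ₂⟩ := (sectionDiffAt_pair_iff ψ x).1 hψ
  simp only [cliffordSum_apply]
  exact Prod.ext (h.clifford_parallel x Y _ hY hψ₁ v) (h.clifford_parallel x Y _ hY hψ₂ v)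

theorem IsSpinLeviCivita.hatD_sumConnection (h : IsSpinLeviCivita C nabla nablaS)
    (X : Π x : M, TangentSpace 𝓘(ℝ, E) x) {Y : Π x : M, TangentSpace 𝓘(ℝ, E) x}
    {ξ : Π x : M, (S ×ᵇ S) x} (hY : SectionDiffAt E E Y x)
    (hξ : SectionDiffAt E (F × F) (V := S ×ᵇ S) ξ x) :
    hatD γ nabla (sumConnection (F := F) nablaS) (sumConnection (F := F) nablaS) X Y ξ x = 0 := by
  rw [hatD, sub_sub, sub_eq_zero]
  exact h.sumConnection_cliffordSum hY hξ (X x)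

end Connections

section Contributions

variable {E : Type*} [NormedAddCommGroup E] [NormedSpace ℝ E]
  {M : Type*} [TopologicalSpace M] [ChartedSpace E M] [IsManifold 𝓘(ℝ, E) ∞ M]
  {F : Type*} [NormedAddCommGroup F] [NormedSpace ℂ F]
  {S : M → Type*} [TopologicalSpace (TotalSpace F S)]
  [∀ x, AddCommGroup (S x)] [∀ x, Module ℂ (S x)] [∀ x, TopologicalSpace (S x)]
  [∀ x, IsTopologicalAddGroup (S x)] [∀ x, ContinuousSMul ℝ (S x)]
  [FiberBundle F S] [VectorBundle ℝ F S]
  {n : ℕ} {g : PseudoRiemannianMetric E M} {γ : CliffordMultiplication F S n g}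
  {C : ChargeConjugation γ} {k : Fin 4}
  {A AC : Π x : M, (S ×ᵇ S) x →L[ℝ] TangentSpace 𝓘(ℝ, E) x →L[ℝ] (S ×ᵇ S) x}
  {P Q : Π x : M, Module.End ℂ (S x × S x)}
  {nabla : CovariantDerivative 𝓘(ℝ, E) E (TangentSpace 𝓘(ℝ, E) : M → Type _)}
  {nablaS : CovariantDerivative 𝓘(ℝ, E) F S}

variable (γ A AC) in
/-- The contribution to `D̂γ` of the contributions `A` to `D` and `AC` to `D^C`, that is
`(u, v) ↦ A_u γ(v) - γ(v) AC_u`. -/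
noncomputable def hatOneForm (x : M) (u v : TangentSpace 𝓘(ℝ, E) x) (ψ : S x × S x) : S x × S x :=
  A x (cliffordSum γ x v ψ) u - cliffordSum γ x v (AC x ψ u)

theorem hatD_addOneForm_sub_hatD {D DC DC' : SumConnection E F S}
    (X Y : Π x : M, TangentSpace 𝓘(ℝ, E) x) {ξ : Π x : M, (S ×ᵇ S) x} {x : M}
    (hAC : AC x (ξ x) (X x) = DC' ξ x (X x) - DC ξ x (X x)) :
    hatD γ nabla (D.addOneForm A) DC' X Y ξ x - hatD γ nabla D DC X Y ξ x
      = hatOneForm γ A AC x (X x) (Y x) (ξ x) := by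
  have hsub : cliffordSum γ x (Y x) (DC' ξ x (X x) - DC ξ x (X x))
      = cliffordSum γ x (Y x) (DC' ξ x (X x)) - cliffordSum γ x (Y x) (DC ξ x (X x)) :=
    map_sub (cliffordSum γ x (Y x)) _ _
  rw [hatD, hatD, hatOneForm, hAC, hsub, addOneForm_apply]
  abel

theorem isConjugateOneForm_difference [FiniteDimensional ℂ F]
    [ContMDiffVectorBundle ∞ F S 𝓘(ℝ, E)] {D DC DC' : SumConnection E F S}
    (h : IsConjugateConnection C k D DC) (h' : IsConjugateConnection C k (D.addOneForm A) DC') :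
    IsConjugateOneForm C k A (DC'.difference DC) := by
  intro x φ ψ v
  obtain ⟨φ, hφ, rfl⟩ := exists_sectionDiffAt_eq (E := E) (G := F × F) (V := S ×ᵇ S) φ
  obtain ⟨ψ, hψ, rfl⟩ := exists_sectionDiffAt_eq (E := E) (G := F × F) (V := S ×ᵇ S) ψ
  have hparallel := (h x φ ψ hφ hψ v).symm.trans (h' x φ ψ hφ hψ v)
  have hadd := chargeSum_add_left C k (D φ x v) (A x (φ x) v) (ψ x)
  have hsub := chargeSum_sub_right C k (φ x) (DC' ψ x v) (DC ψ x v)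
  rw [addOneForm_apply] at hparallel
  rw [difference_apply DC' DC hψ v]
  linear_combination hsub - hparallel - hadd

/-- The contribution `A` to `D`, with contribution `AC` to `D^C`, is admissible: its contribution to
`D̂γ` is skew symmetric. -/
def IsAdmissibleOneForm (γ : CliffordMultiplication F S n g)
    (A AC : Π x : M, (S ×ᵇ S) x →L[ℝ] TangentSpace 𝓘(ℝ, E) x →L[ℝ] (S ×ᵇ S) x) : Prop :=
  ∀ (x : M) (u v : TangentSpace 𝓘(ℝ, E) x) (ψ : S x × S x),
    hatOneForm γ A AC x u v ψ = -hatOneForm γ A AC x v u ψ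

theorem IsAdmissible.isAdmissibleOneForm [FiniteDimensional ℂ F]
    [VectorBundle ℂ F S] [ContMDiffVectorBundle ∞ F S 𝓘(ℝ, E)]
    (hS : IsSpinLeviCivita C nabla nablaS)
    (hA : IsAdmissible C k nabla ((sumConnection (F := F) nablaS).addOneForm A))
    (hAC : IsConjugateOneForm C k A AC) : IsAdmissibleOneForm γ A AC := by
  obtain ⟨DC, hDC, hskew⟩ := hA
  obtain rfl := hAC.unique
    (isConjugateOneForm_difference (hS.isConjugateConnection_sumConnection k) hDC)
  intro x u v ψ
  obtain ⟨X, hX, rfl⟩ := exists_sectionDiffAt_eq (E := E) (G := E)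
    (V := (TangentSpace 𝓘(ℝ, E) : M → Type _)) u
  obtain ⟨Y, hY, rfl⟩ := exists_sectionDiffAt_eq (E := E) (G := E)
    (V := (TangentSpace 𝓘(ℝ, E) : M → Type _)) v
  obtain ⟨ξ, hξ, rfl⟩ := exists_sectionDiffAt_eq (E := E) (G := F × F) (V := S ×ᵇ S) ψ
  rw [← hatD_addOneForm_sub_hatD (nabla := nabla) X Y (difference_apply DC _ hξ (X x)),
    ← hatD_addOneForm_sub_hatD (nabla := nabla) Y X (difference_apply DC _ hξ (Y x)),
    hS.hatD_sumConnection X hY hξ, hS.hatD_sumConnection Y hX hξ, sub_zero, sub_zero]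
  exact hskew x X Y ξ hX hY hξ

theorem IsAdmissibleOneForm.apply_cliffordSum (h : IsAdmissibleOneForm γ A AC) {x : M}
    (v : TangentSpace 𝓘(ℝ, E) x) (ψ : S x × S x) :
    A x (cliffordSum γ x v ψ) v = cliffordSum γ x v (AC x ψ v) := by
  have : IsAddTorsionFree (S x × S x) := .of_isTorsionFree ℂ _
  exact sub_eq_zero.1 (self_eq_neg.1 (h x v v ψ))

theorem IsProportionalOneForm.of_isAdmissibleOneForm [FiniteDimensional ℝ E]
    (hPQ : ∀ x v, SemiconjBy (cliffordSum γ x v) (Q x) (P x)) (hA : IsProportionalOneForm A P)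
    (h : IsAdmissibleOneForm γ A AC) : IsProportionalOneForm AC Q := by
  obtain ⟨B, hB⟩ := hA
  have hexists (x : M) : ∃ B' : TangentSpace 𝓘(ℝ, E) x →ₗ[ℝ] Module.End ℂ (S x),
      ∀ v (ψ : S x × S x), AC x ψ v = twist (B' v) 1 (Q x ψ) := by
    obtain ⟨e, he⟩ := g.exists_basis_forall_self_ne_zero x
    refine exists_eq_twist_of_basis e (Q x) (fun ψ ↦ (AC x ψ).toLinearMap) fun l ↦ ?_
    obtain ⟨c, hc⟩ := γ.exists_mul_toEnd_eq_one (he l)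
    exact ⟨c * B x (e l) * γ.toEnd x (e l), fun ψ ↦ eq_twist_of_semiconjBy hc (hPQ x (e l)) _
      ((hB x (e l) _).symm.trans (h.apply_cliffordSum (e l) ψ))⟩
  choose B' hB' using hexists
  exact ⟨B', hB'⟩

theorem exists_hatOneForm_eq_twist (hPQ : ∀ x v, SemiconjBy (cliffordSum γ x v) (Q x) (P x))
    (hA : IsProportionalOneForm A P) (hAC : IsProportionalOneForm AC Q) :
    ∃ B : Π x : M, TangentSpace 𝓘(ℝ, E) x →ₗ[ℝ] TangentSpace 𝓘(ℝ, E) x →ₗ[ℝ]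
        Module.End ℂ (S x),
      ∀ x u v ψ, hatOneForm γ A AC x u v ψ = twist (B x u v) 1 (Q x ψ) := by
  obtain ⟨B, hB⟩ := hA
  obtain ⟨B', hB'⟩ := hAC
  refine ⟨fun x ↦ (LinearMap.mul ℝ (Module.End ℂ (S x))).compl₁₂ (B x) (γ.toEndₗ x)
    - ((LinearMap.mul ℝ (Module.End ℂ (S x))).compl₁₂ (γ.toEndₗ x) (B' x)).flip,
    fun x u v ψ ↦ ?_⟩
  have hPγ : P x (cliffordSum γ x v ψ) = cliffordSum γ x v (Q x ψ) :=
    (LinearMap.congr_fun (hPQ x v).eq ψ).symm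
  calc hatOneForm γ A AC x u v ψ
      = twist (B x u) 1 (cliffordSum γ x v (Q x ψ))
          - cliffordSum γ x v (twist (B' x u) 1 (Q x ψ)) := by
        rw [hatOneForm, hB, hB', hPγ]
    _ = twist (B x u * γ.toEnd x v - γ.toEnd x v * B' x u) 1 (Q x ψ) := by
        rw [twist_sub_left, twist_mul, twist_mul]
        rfl

theorem isProportionalTwoForm_spinTorsion_sub {D DC DC' : SumConnection E F S}
    (hPQ : ∀ x v, SemiconjBy (cliffordSum γ x v) (Q x) (P x))
    (hA : IsProportionalOneForm A P) (hAC : IsProportionalOneForm AC Q)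
    (hdiff : ∀ (x : M) (ξ : Π x : M, (S ×ᵇ S) x), SectionDiffAt E (F × F) (V := S ×ᵇ S) ξ x →
      ∀ v : TangentSpace 𝓘(ℝ, E) x, AC x (ξ x) v = DC' ξ x v - DC ξ x v) :
    IsProportionalTwoForm (F := F)
      (fun X Y ξ ↦ spinTorsion γ nabla (D.addOneForm A) DC' X Y ξ
        - spinTorsion γ nabla D DC X Y ξ) Q := by
  obtain ⟨B, hB⟩ := exists_hatOneForm_eq_twist hPQ hA hAC
  refine ⟨fun x ↦ B x - (B x).flip, fun x v ↦ by simp, fun x X Y ξ _ _ hξ ↦ ?_⟩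
  calc spinTorsion γ nabla (D.addOneForm A) DC' X Y ξ x - spinTorsion γ nabla D DC X Y ξ x
      = hatOneForm γ A AC x (X x) (Y x) (ξ x) - hatOneForm γ A AC x (Y x) (X x) (ξ x) := by
        rw [← hatD_addOneForm_sub_hatD (nabla := nabla) X Y (hdiff x ξ hξ (X x)),
          ← hatD_addOneForm_sub_hatD (nabla := nabla) Y X (hdiff x ξ hξ (Y x)), spinTorsion,
          spinTorsion]
        abel
    _ = twist (B x (X x) (Y x) - B x (Y x) (X x)) 1 (Q x (ξ x)) := by
        rw [hB, hB, twist_sub_left, LinearMap.sub_apply]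

end Contributions

end SpinTorsion

open SpinTorsion

theorem proposition4p13_general
    {E : Type*} [NormedAddCommGroup E] [NormedSpace ℝ E] [FiniteDimensional ℝ E]
    {M : Type*} [TopologicalSpace M] [ChartedSpace E M] [IsManifold 𝓘(ℝ, E) ∞ M]
    {F : Type*} [NormedAddCommGroup F] [NormedSpace ℂ F] [FiniteDimensional ℂ F]
    {S : M → Type*} [TopologicalSpace (TotalSpace F S)]
    [∀ x, AddCommGroup (S x)] [∀ x, Module ℂ (S x)] [∀ x, TopologicalSpace (S x)]
    [∀ x, IsTopologicalAddGroup (S x)] [∀ x, ContinuousSMul ℝ (S x)]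
    [FiberBundle F S] [VectorBundle ℂ F S] [VectorBundle ℝ F S]
    [ContMDiffVectorBundle ∞ F S 𝓘(ℝ, E)]
    {n : ℕ} {g : PseudoRiemannianMetric E M} {γ : CliffordMultiplication F S n g}
    {C : ChargeConjugation γ} {k : Fin 4}
    {nabla : CovariantDerivative 𝓘(ℝ, E) E (TangentSpace 𝓘(ℝ, E) : M → Type _)}
    {nablaS : CovariantDerivative 𝓘(ℝ, E) F S} (hnablaS : IsSpinLeviCivita C nabla nablaS)
    {P Q : Π x : M, Module.End ℂ (S x × S x)}
    (hPQ : ∀ x v, SemiconjBy (cliffordSum γ x v) (Q x) (P x))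
    {A : Π x : M, (S ×ᵇ S) x →L[ℝ] TangentSpace 𝓘(ℝ, E) x →L[ℝ] (S ×ᵇ S) x}
    (hA : IsProportionalOneForm A P)
    (hadm : IsAdmissible C k nabla ((sumConnection (F := F) nablaS).addOneForm A))
    {D DC D₀C : SumConnection E F S} (hDC : IsConjugateConnection C k D DC)
    (hD₀C : IsConjugateConnection C k (D.addOneForm (fun x ↦ -A x)) D₀C) :
    IsProportionalOneForm (DC.difference D₀C) Q ∧
      IsProportionalTwoForm (F := F)
        (fun X Y ξ ↦ spinTorsion γ nabla D DC X Y ξ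
          - spinTorsion γ nabla (D.addOneForm (fun x ↦ -A x)) D₀C X Y ξ) Q := by
  have hD := addOneForm_neg_addOneForm D A
  have hAC : IsConjugateOneForm C k A (DC.difference D₀C) :=
    isConjugateOneForm_difference hD₀C (hD.symm ▸ hDC)
  have hQ : IsProportionalOneForm (DC.difference D₀C) Q :=
    hA.of_isAdmissibleOneForm hPQ (hadm.isAdmissibleOneForm hnablaS hAC)
  have htorsion := isProportionalTwoForm_spinTorsion_sub (nabla := nabla)
    (D := D.addOneForm fun x ↦ -A x) hPQ hA hQ
    fun _ _ hξ v ↦ difference_apply DC D₀C hξ v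
  rw [hD] at htorsion
  exact ⟨hQ, htorsion⟩

theorem proposition4p13
    {E : Type*} [NormedAddCommGroup E] [NormedSpace ℝ E] [FiniteDimensional ℝ E]
    {M : Type*} [TopologicalSpace M] [T2Space M] [ChartedSpace E M] [IsManifold 𝓘(ℝ, E) ∞ M]
    {F : Type*} [NormedAddCommGroup F] [NormedSpace ℂ F] [FiniteDimensional ℂ F]
    {S : M → Type*} [TopologicalSpace (TotalSpace F S)]
    [∀ x, AddCommGroup (S x)] [∀ x, Module ℂ (S x)] [∀ x, TopologicalSpace (S x)]
    [∀ x, IsTopologicalAddGroup (S x)] [∀ x, ContinuousSMul ℝ (S x)]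
    [FiberBundle F S] [VectorBundle ℂ F S] [VectorBundle ℝ F S]
    [ContMDiffVectorBundle ∞ F S 𝓘(ℝ, E)]
    (n : ℕ) (hn : Module.finrank ℝ E = 2 * n)
    (g : SpinTorsion.PseudoRiemannianMetric E M)
    (γ : SpinTorsion.CliffordMultiplication F S n g)
    (γs : Π x : M, Module.End ℂ (S x)) (hγs : SpinTorsion.IsChiralityOperator γ γs)
    (C : SpinTorsion.ChargeConjugation γ)
    (nabla : CovariantDerivative 𝓘(ℝ, E) E (TangentSpace 𝓘(ℝ, E) : M → Type _))
    (hnabla : SpinTorsion.IsLeviCivita g nabla)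
    (nablaS : CovariantDerivative 𝓘(ℝ, E) F S)
    (hnablaS : SpinTorsion.IsSpinLeviCivita C nabla nablaS)
    -- the charge conjugation `C ⊗ τ_k` and the operator `1 ⊗ τ_i + w γ* ⊗ τ_j`
    (k i j : Fin 4) (w : ℤˣ)
    -- an admissible contribution proportional to the operator
    (A : Π x : M, (S ×ᵇ S) x →L[ℝ] TangentSpace 𝓘(ℝ, E) x →L[ℝ] (S ×ᵇ S) x)
    (hA : SpinTorsion.IsProportionalOneForm A (SpinTorsion.chiralProjection γs i j w))
    (hadm : SpinTorsion.IsAdmissible C k nabla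
      ((SpinTorsion.sumConnection (F := F) nablaS).addOneForm A))
    -- the connection `D`, and the connection `D - A` without the contribution
    (D DC D₀C : SpinTorsion.SumConnection E F S)
    (hD : SpinTorsion.IsComplexLinear D)
    (hDC : SpinTorsion.IsConjugateConnection C k D DC)
    (hD₀C : SpinTorsion.IsConjugateConnection C k (D.addOneForm (fun x ↦ -A x)) D₀C) :
    SpinTorsion.IsProportionalOneForm (DC.difference D₀C)
        (SpinTorsion.chiralProjection γs i j (-w)) ∧
      SpinTorsion.IsProportionalTwoForm (F := F)
        (fun X Y ξ ↦ SpinTorsion.spinTorsion γ nabla D DC X Y ξ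
          - SpinTorsion.spinTorsion γ nabla (D.addOneForm (fun x ↦ -A x)) D₀C X Y ξ)
        (SpinTorsion.chiralProjection γs i j (-w)) :=
  proposition4p13_general hnablaS (hγs.semiconjBy_chiralProjection γ i j w) hA hadm hDC hD₀C
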